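/- Let $\rho>0$ and let $G$ be a relaxation modulus, not identically zero on $]0,\infty[$, with a positive relaxation spectrum: there is a positive measure $\mu$ on $[0,\infty[$ with $\int_{[0,\infty[}\frac{\mu(dr)}{1+r}<\infty$ and $$G(t)=\int_{[0,\infty[}e^{-tr}\,\mu(dr)\qquad(t>0).$$ For $\operatorname{Re}p>0$ let $\tilde G(p)=\int_0^\infty e^{-pt}G(t)\,dt$ and $$Q(p)=p\,\tilde G(p),\qquad B(p)=p\,\frac{\rho^{1/2}}{Q(p)^{1/2}}$$ (principal square root). Let $c_0=\sqrt{G(0+)/\rho}$ be the wavefront speed, where $G(0+)=\lim_{t\to0+}G(t)\in[0,\infty]$, with $1/c_0=0$ if $c_0=\infty$. A function $f$ is completely monotone if it is infinitely differentiable on $]0,\infty[$ and $(-1)^nf^{(n)}(t)\ge0$ for all integers $n\ge0$ and all $t>0$. A Bernstein function is a non-negative differentiable function on $]0,\infty[$ whose derivative is completely monotone. A complete Bernstein function is a real function on $]0,\infty[$ of the form $x\mapsto x^2\tilde g(x)$, where $\tilde g$ is the Laplace transform of a Bernstein function $g$. An admissible dispersion–attenuation function is a function $b$ of the form $$b(p)=p\int_{]0,\infty[}\frac{\nu(dr)}{p+r}$$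 on the complex plane cut along the negative real axis, where $\nu$ is a positive measure on $]0,\infty[$ with $\int_{]0,\infty[}\frac{\nu(dr)}{1+r}<\infty$. Then $G$ is completely monotone; $B$ is real-valued on $]0,\infty[$, and its restriction to $]0,\infty[$ is a complete Bernstein function; $0<c_0\le\infty$ and $\lim_{p\to+\infty}B(p)/p=1/c_0$; and there is an admissible dispersion–attenuation function $b$ such that $$B(p)=\frac{p}{c_0}+b(p)\qquad\text{for all }p\text{ with }\operatorname{Re}p>0.$$ -/

import Mathlib

open scoped ENNReal ContDiff

namespace Viscoelastic

noncomputable section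

/-- The Laplace transform `∫₀^∞ e^{-pt} f(t) dt` of a real function on the positive half-line,
at a complex argument `p`. -/
def laplace (f : ℝ → ℝ) (p : ℂ) : ℂ :=
  ∫ t in Set.Ioi (0 : ℝ), Complex.exp (-p * (t : ℂ)) * (f t : ℂ)

/-- Complete monotonicity on `]0, ∞[`: infinitely differentiable, with derivatives of
alternating signs. -/
def IsCompletelyMonotone (f : ℝ → ℝ) : Prop :=
  ContDiffOn ℝ ∞ f (Set.Ioi 0) ∧
    ∀ n : ℕ, ∀ t : ℝ, 0 < t → 0 ≤ (-1 : ℝ) ^ n * iteratedDeriv n f t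

/-- A Bernstein function on `]0, ∞[`: differentiable and non-negative, with a completely monotone
derivative. -/
def IsBernstein (f : ℝ → ℝ) : Prop :=
  DifferentiableOn ℝ f (Set.Ioi 0) ∧ (∀ t : ℝ, 0 < t → 0 ≤ f t) ∧ IsCompletelyMonotone (deriv f)

/-- A complete Bernstein function on `]0, ∞[`: `f(x) = x² g̃(x)` for a Bernstein function `g`,
where `g̃` is the Laplace transform of `g`. -/
def IsCompleteBernstein (f : ℝ → ℝ) : Prop :=
  ∃ g : ℝ → ℝ, IsBernstein g ∧
    ∀ x : ℝ, 0 < x → (f x : ℂ) = (x : ℂ) ^ 2 * laplace g (x : ℂ)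

/-- `μ` is a positive measure on `[0, ∞[` with `∫ μ(dr) / (1 + r) < ∞`
(as a measure on `ℝ` that does not charge the negative half-line). -/
def IsRelaxationMeasure (μ : MeasureTheory.Measure ℝ) : Prop :=
  μ (Set.Iio 0) = 0 ∧ ∫⁻ r, ENNReal.ofReal (1 / (1 + r)) ∂μ < ⊤

/-- `G` has a positive relaxation spectrum: it is a superposition
`G(t) = ∫ e^{-tr} μ(dr)`, `t > 0`, of exponential relaxations, where `μ` is a positive measure on
`[0, ∞[` with `∫ μ(dr) / (1 + r) < ∞`. -/
def HasPositiveRelaxationSpectrum (G : ℝ → ℝ) : Prop :=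
  ∃ μ : MeasureTheory.Measure ℝ, IsRelaxationMeasure μ ∧
    ∀ t : ℝ, 0 < t → G t = ∫ r, Real.exp (-(t * r)) ∂μ

/-- `Q(p) = p G̃(p)`. -/
def Q (G : ℝ → ℝ) (p : ℂ) : ℂ := p * laplace G p

/-- `B(p) = p ρ^{1/2} / Q(p)^{1/2}`, with the principal branch of the square root. -/
def B (ρ : ℝ) (G : ℝ → ℝ) (p : ℂ) : ℂ :=
  p * (Real.sqrt ρ : ℂ) / Q G p ^ (1 / 2 : ℂ)

/-- The wavefront speed `(G(0+) / ρ)^{1/2}`, an element of `[0, ∞]`. The relaxation moduli under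
consideration are non-increasing on `]0, ∞[`, so that `G(0+)`, finite or not, is the supremum of
the values of `G`. -/
def wavefrontSpeed (ρ : ℝ) (G : ℝ → ℝ) : ℝ≥0∞ :=
  ((⨆ t : Set.Ioi (0 : ℝ), ENNReal.ofReal (G t)) / ENNReal.ofReal ρ) ^ (1 / 2 : ℝ)

/-- `ν` is a positive measure on `]0, ∞[` with `∫ ν(dr) / (1 + r) < ∞`
(as a measure on `ℝ` that does not charge `]-∞, 0]`). -/
def IsSpectralMeasure (ν : MeasureTheory.Measure ℝ) : Prop :=
  ν (Set.Iic 0) = 0 ∧ ∫⁻ r, ENNReal.ofReal (1 / (1 + r)) ∂ν < ⊤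

/-- An admissible dispersion-attenuation function: `b(p) = p ∫ ν(dr) / (p + r)` on the complex
plane cut along the negative real axis, for a positive measure `ν` on `]0, ∞[` with
`∫ ν(dr) / (1 + r) < ∞`. -/
def IsAdmissible (b : ℂ → ℂ) : Prop :=
  ∃ ν : MeasureTheory.Measure ℝ, IsSpectralMeasure ν ∧
    ∀ p ∈ Complex.slitPlane, b p = p * ∫ r, 1 / (p + (r : ℂ)) ∂ν

end

end Viscoelastic

open MeasureTheory Filter Topology

namespace Viscoelastic

/-! The Laplace transform of `G` is the Stieltjes function `F(p) = ∫ μ(dr) / (p + r)`, and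
everything follows once `(p F(p))^(-1/2)` is known to be a Stieltjes function too: multiplying its
integral representation by `p √ρ` gives `B`.

Under `u = r / (1 + r)`, Stieltjes functions become integrals of `1 / (p (1 - u) + u)` against
finite measures on the compact interval `[0, 1]`, where `u = 0` stands for the term `1 / p` and `u =
1` for constants. Compactness makes this cone closed under pointwise limits
(`IsStieltjes.of_tendsto`).

The cone is stable under `F ↦ 1 / (p F)` (`IsStieltjes.inv_mul`). For finitely many atoms this is a
rank-one resolvent identity combined with diagonalization of a positive semidefinite matrix
(`exists_inv_sum_eq`); the general case is a limit. Newton's iteration for `(p F)^(-1/2)` uses only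
sums, positive multiples and this involution, so its limit is Stieltjes
(`IsStieltjes.inv_sqrt_mul`).

In the measure representing `B(p) / p`, the atom at `u = 1` is the limit at `+∞`, hence `1 / c₀`;
the atom at `u = 0` vanishes by comparison with `1 / (p F)`; the rest, carried back to `]0, ∞[`, is
the spectral measure of `b`. Integrating `e^{-tr}` against it in `t` gives the Bernstein function
behind `B`. -/

/-! ### The Stieltjes kernel on the compactified half-line. -/

/-- Denominators of the Stieltjes kernel on the compactified half-line `[0, ∞]`, parametrized by
`u = r / (1 + r)`. -/
noncomputable def den (p : ℂ) (u : unitInterval) : ℂ := p * (1 - ((u : ℝ) : ℂ)) + ((u : ℝ) : ℂ)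

lemma den_re (p : ℂ) (u : unitInterval) : (den p u).re = p.re * (1 - (u : ℝ)) + u := by
  simp [den]

lemma min_le_den_re (p : ℂ) (u : unitInterval) : min p.re 1 ≤ (den p u).re := by
  rw [den_re]
  have h0 := u.2.1
  have h1 := u.2.2
  have h2 := min_le_left p.re 1
  have h3 := min_le_right p.re 1
  nlinarith [mul_nonneg (sub_nonneg.2 h2) (sub_nonneg.2 h1), mul_nonneg (sub_nonneg.2 h3) h0]

lemma den_re_pos {p : ℂ} (hp : 0 < p.re) (u : unitInterval) : 0 < (den p u).re :=
  (lt_min hp one_pos).trans_le (min_le_den_re p u)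

lemma den_ne_zero {p : ℂ} (hp : 0 < p.re) (u : unitInterval) : den p u ≠ 0 := by
  intro h
  have := den_re_pos hp u
  simp [h] at this

lemma continuous_den (p : ℂ) : Continuous (den p) := by
  unfold den
  fun_prop

lemma continuous_inv_den {p : ℂ} (hp : 0 < p.re) : Continuous fun u => (den p u)⁻¹ :=
  (continuous_den p).inv₀ (den_ne_zero hp)

lemma norm_inv_den_le {p : ℂ} (hp : 0 < p.re) (u : unitInterval) :
    ‖(den p u)⁻¹‖ ≤ (min p.re 1)⁻¹ := by
  rw [norm_inv]
  exact inv_anti₀ (lt_min hp one_pos) ((min_le_den_re p u).trans (Complex.re_le_norm _))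

lemma integrable_inv_den {p : ℂ} (hp : 0 < p.re) (σ : Measure unitInterval) [IsFiniteMeasure σ] :
    Integrable (fun u => (den p u)⁻¹) σ :=
  Integrable.of_bound (continuous_inv_den hp).aestronglyMeasurable _
    (Eventually.of_forall (norm_inv_den_le hp))

lemma inv_re_pos {z : ℂ} (hz : 0 < z.re) : 0 < (z⁻¹).re := by
  rw [Complex.inv_re]
  refine div_pos hz (Complex.normSq_pos.2 ?_)
  rintro rfl
  simp at hz

/-- The reciprocal of `p / den p u` is the convex combination `(1 - u) + u / p` of two points of the
right half-plane. -/
lemma mul_inv_den_re_pos {p : ℂ} (hp : 0 < p.re) {u : unitInterval} :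
    0 < (p * (den p u)⁻¹).re := by
  have hp0 : p ≠ 0 := by rintro rfl; simp at hp
  have h : p * (den p u)⁻¹ = ((1 - ((u : ℝ) : ℂ)) + ((u : ℝ) : ℂ) * p⁻¹)⁻¹ := by
    rw [← inv_inj, inv_inv, mul_inv, inv_inv, den]
    field_simp
  rw [h]
  apply inv_re_pos
  have h0 := u.2.1
  have h1 := u.2.2
  have h2 := inv_re_pos hp
  simp only [Complex.add_re, Complex.sub_re, Complex.one_re, Complex.ofReal_re,
    Complex.re_ofReal_mul]
  rcases h1.lt_or_eq with h1 | h1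
  · nlinarith [mul_nonneg h0 h2.le]
  · rw [h1]; linarith

/-! ### The cone of Stieltjes functions and its closure under limits. -/

/-- Nonzero Stieltjes functions on the right half-plane, represented by a finite measure on the
compactified half-line. -/
def IsStieltjes (F : ℂ → ℂ) : Prop :=
  ∃ σ : Measure unitInterval, IsFiniteMeasure σ ∧ σ ≠ 0 ∧
    ∀ p : ℂ, 0 < p.re → F p = ∫ u, (den p u)⁻¹ ∂σ

lemma integral_re_pos {α : Type*} [MeasurableSpace α] {σ : Measure α} (hσ : σ ≠ 0) {f : α → ℂ}
    (hf : Integrable f σ) (hpos : ∀ u, 0 < (f u).re) : 0 < (∫ u, f u ∂σ).re := by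
  have h : (∫ u, f u ∂σ).re = ∫ u, (f u).re ∂σ := by
    simpa using (integral_re hf).symm
  rw [h, integral_pos_iff_support_of_nonneg (fun u => (hpos u).le) hf.re]
  have : Function.support (fun u => (f u).re) = Set.univ :=
    Set.eq_univ_of_forall fun u => (hpos u).ne'
  rw [this]
  exact Measure.measure_univ_pos.2 hσ

lemma IsStieltjes.re_pos {F : ℂ → ℂ} (hF : IsStieltjes F) {p : ℂ} (hp : 0 < p.re) :
    0 < (F p).re := by
  obtain ⟨σ, _, hσ, h⟩ := hF
  rw [h p hp]
  exact integral_re_pos hσ (integrable_inv_den hp σ) fun u => inv_re_pos (den_re_pos hp u)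

lemma IsStieltjes.mul_re_pos {F : ℂ → ℂ} (hF : IsStieltjes F) {p : ℂ} (hp : 0 < p.re) :
    0 < (p * F p).re := by
  obtain ⟨σ, _, hσ, h⟩ := hF
  rw [h p hp, ← integral_const_mul]
  exact integral_re_pos hσ ((integrable_inv_den hp σ).const_mul _) fun u =>
    mul_inv_den_re_pos hp

lemma ne_zero_of_re_pos {z : ℂ} (hz : 0 < z.re) : z ≠ 0 := by
  rintro rfl
  simp at hz

lemma IsStieltjes.congr {F H : ℂ → ℂ} (hF : IsStieltjes F)
    (h : ∀ p : ℂ, 0 < p.re → H p = F p) : IsStieltjes H := by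
  obtain ⟨σ, h1, h2, h3⟩ := hF
  exact ⟨σ, h1, h2, fun p hp => (h p hp).trans (h3 p hp)⟩

lemma IsStieltjes.add {F H : ℂ → ℂ} (hF : IsStieltjes F) (hH : IsStieltjes H) :
    IsStieltjes fun p => F p + H p := by
  obtain ⟨σ, _, h2, h3⟩ := hF
  obtain ⟨τ, _, h5, h6⟩ := hH
  refine ⟨σ + τ, inferInstance, ?_, fun p hp => ?_⟩
  · intro h
    apply h2
    rw [← Measure.measure_univ_eq_zero] at h ⊢
    simp only [Measure.coe_add, Pi.add_apply, add_eq_zero] at h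
    exact h.1
  · beta_reduce
    rw [integral_add_measure (integrable_inv_den hp σ) (integrable_inv_den hp τ), h3 p hp,
      h6 p hp]

lemma IsStieltjes.smul {F : ℂ → ℂ} (hF : IsStieltjes F) {c : ℝ} (hc : 0 < c) :
    IsStieltjes fun p => (c : ℂ) * F p := by
  obtain ⟨σ, _, h2, h3⟩ := hF
  refine ⟨c.toNNReal • σ, inferInstance, ?_, fun p hp => ?_⟩
  · intro h
    apply h2
    rw [← Measure.measure_univ_eq_zero] at h ⊢
    simpa [hc.not_ge] using h
  · beta_reduce
    rw [integral_smul_nnreal_measure, h3 p hp, NNReal.smul_def, Complex.real_smul,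
      Real.coe_toNNReal _ hc.le]

lemma isStieltjes_dirac (u : unitInterval) : IsStieltjes fun p => (den p u)⁻¹ :=
  ⟨Measure.dirac u, inferInstance, NeZero.ne _, fun p hp => by simp⟩

lemma isStieltjes_const {c : ℝ} (hc : 0 < c) : IsStieltjes fun _ => (c : ℂ) := by
  refine ((isStieltjes_dirac 1).smul hc).congr fun p hp => ?_
  simp [den]

lemma isStieltjes_inv_add {r : ℝ} (hr : 0 ≤ r) : IsStieltjes fun p => (p + (r : ℂ))⁻¹ := by
  have h1 : 0 < 1 + r := by linarith
  refine ((isStieltjes_dirac ⟨r / (1 + r), by positivity, (div_le_one h1).2 (by linarith)⟩).smul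
    (inv_pos.2 h1)).congr fun p hp => ?_
  have h2 : (1 + (r : ℂ)) ≠ 0 := by exact_mod_cast h1.ne'
  simp only [den]
  push_cast
  rw [← mul_inv]
  congr 1
  field_simp
  ring

lemma IsStieltjes.add_sum {F : ℂ → ℂ} (hF : IsStieltjes F) {ι : Type*} (s : Finset ι)
    {w l : ι → ℝ} (hw : ∀ i, 0 ≤ w i) (hl : ∀ i, 0 ≤ l i) :
    IsStieltjes fun p => F p + ∑ i ∈ s, (w i : ℂ) * (p + (l i : ℂ))⁻¹ := by
  classical
  induction s using Finset.induction_on with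
  | empty => simpa using hF
  | insert i s his ih =>
    rcases (hw i).eq_or_lt with h | h
    · refine ih.congr fun p hp => ?_
      rw [Finset.sum_insert his, ← h]
      simp
    · refine (ih.add ((isStieltjes_inv_add (hl i)).smul h)).congr fun p hp => ?_
      rw [Finset.sum_insert his]
      ring

/-- Since `den 1 u = 1`, the value at `p = 1` is the total mass, so the masses converge; the
normalized measures stay in a compact space. The condition `H 1 ≠ 0` keeps the limit measure from
vanishing. -/
lemma IsStieltjes.of_tendsto {F : ℕ → ℂ → ℂ} {H : ℂ → ℂ} (hF : ∀ n, IsStieltjes (F n))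
    (hH : H 1 ≠ 0) (h : ∀ p : ℂ, 0 < p.re → Tendsto (fun n => F n p) atTop (𝓝 (H p))) :
    IsStieltjes H := by
  choose σ hfin hne hσ using hF
  let S : ℕ → FiniteMeasure unitInterval := fun n => ⟨σ n, hfin n⟩
  have hS (n : ℕ) (p : ℂ) (hp : 0 < p.re) :
      F n p = ((S n).mass : ℂ) * ∫ u, (den p u)⁻¹ ∂((S n).normalize : Measure unitInterval) := by
    have h1 : (σ n : Measure unitInterval)
        = (S n).mass • ((S n).normalize : Measure unitInterval) :=
      congrArg Subtype.val (S n).self_eq_mass_smul_normalize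
    rw [hσ n p hp, h1, integral_smul_nnreal_measure, NNReal.smul_def, Complex.real_smul]
  have h1 : (0 : ℝ) < (1 : ℂ).re := by simp
  have hden1 (u : unitInterval) : den 1 u = 1 := by simp [den]
  have hmass (n : ℕ) : F n 1 = ((S n).mass : ℂ) := by
    rw [hS n 1 h1]
    simp [hden1]
  -- A limit along an ultrafilter replaces the choice of a convergent subsequence.
  obtain ⟨P, -, hP⟩ := (isCompact_univ (X := ProbabilityMeasure unitInterval)).ultrafilter_le_nhds
    ((hyperfilter ℕ).map fun n => (S n).normalize) (by simp)
  have hP' : Tendsto (fun n => (S n).normalize) (hyperfilter ℕ) (𝓝 P) := hP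
  have hlim {p : ℂ} (hp : 0 < p.re) :
      Tendsto (fun n => F n p) (hyperfilter ℕ) (𝓝 (H p)) :=
    (h p hp).mono_left Nat.hyperfilter_le_atTop
  have key (p : ℂ) (hp : 0 < p.re) : H p = H 1 * ∫ u, (den p u)⁻¹ ∂(P : Measure unitInterval) := by
    refine tendsto_nhds_unique (hlim hp) ?_
    have h2 := (ProbabilityMeasure.tendsto_iff_forall_integral_rclike_tendsto ℂ).1 hP'
      (BoundedContinuousFunction.mkOfCompact ⟨_, continuous_inv_den hp⟩)
    refine ((hlim h1).mul h2).congr fun n => ?_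
    rw [hmass, hS n p hp]
    rfl
  have hre : Tendsto (fun n => ((S n).mass : ℝ)) atTop (𝓝 (H 1).re) := by
    refine ((Complex.continuous_re.tendsto _).comp (h 1 h1)).congr fun n => ?_
    simp [hmass]
  have h0 : 0 ≤ (H 1).re := ge_of_tendsto' hre fun n => NNReal.coe_nonneg _
  have him : H 1 = ((H 1).re : ℂ) := by
    refine tendsto_nhds_unique (h 1 h1) ?_
    refine ((Complex.continuous_ofReal.tendsto _).comp hre).congr fun n => ?_
    simp [hmass]
  have hpos : 0 < (H 1).re := by
    refine h0.lt_of_ne fun h => hH ?_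
    rw [him, ← h, Complex.ofReal_zero]
  refine IsStieltjes.congr (IsStieltjes.smul (F := fun p => ∫ u, (den p u)⁻¹ ∂(P : Measure _))
    ⟨P, inferInstance, NeZero.ne _, fun p hp => rfl⟩ hpos) fun p hp => ?_
  rw [key p hp, ← him]

/-! ### The involution `F ↦ 1 / (p F)`. -/

lemma exists_eigenbasis {ι : Type*} [Fintype ι] [DecidableEq ι] {T : Matrix ι ι ℝ}
    (hT : T.PosSemidef) :
    ∃ (e : ι → ι → ℝ) (l : ι → ℝ), (∀ k, 0 ≤ l k) ∧
      (∀ k i, ∑ j, T i j * e k j = l k * e k i) ∧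
      ∀ i j, ∑ k, e k i * e k j = if i = j then 1 else 0 := by
  refine ⟨fun k i => hT.1.eigenvectorBasis k i, hT.1.eigenvalues, hT.eigenvalues_nonneg,
    fun k i => ?_, fun i j => ?_⟩
  · simpa [Matrix.mulVec, dotProduct] using congrFun (hT.1.mulVec_eigenvectorBasis k) i
  · have h := hT.1.eigenvectorBasis.sum_inner_mul_inner
      (EuclideanSpace.single i (1 : ℝ)) (EuclideanSpace.single j (1 : ℝ))
    simpa [EuclideanSpace.inner_single_left, EuclideanSpace.inner_single_right, eq_comm,
      Pi.single_apply] using h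

/-- The operator `diag r - v vᵀ / M` with `v = √(m r)` and `M = ∑ m`. -/
noncomputable def rankOneDowndate {ι : Type*} [Fintype ι] [DecidableEq ι] (m r : ι → ℝ) :
    Matrix ι ι ℝ :=
  Matrix.of fun i j =>
    (if i = j then r i else 0) - √(m i * r i) * √(m j * r j) / ∑ k, m k

lemma posSemidef_rankOneDowndate {ι : Type*} [Fintype ι] [DecidableEq ι] {m r : ι → ℝ}
    (hm : ∀ i, 0 ≤ m i) (hr : ∀ i, 0 ≤ r i) (hM : 0 < ∑ i, m i) :
    (rankOneDowndate m r).PosSemidef := by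
  refine Matrix.PosSemidef.of_dotProduct_mulVec_nonneg ?_ fun x => ?_
  · ext i j
    simp only [rankOneDowndate, Matrix.conjTranspose_apply, Matrix.of_apply, star_trivial]
    rw [mul_comm]
    by_cases h : i = j
    · rw [h]
    · rw [if_neg h, if_neg (Ne.symm h)]
  · have h1 : star x ⬝ᵥ (rankOneDowndate m r).mulVec x
        = ∑ i, r i * x i ^ 2 - (∑ i, √(m i * r i) * x i) ^ 2 / ∑ k, m k := by
      simp only [rankOneDowndate, dotProduct, Matrix.mulVec, Matrix.of_apply, star_trivial,
        Finset.mul_sum, sub_mul, mul_sub, Finset.sum_sub_distrib]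
      congr 1
      · refine Finset.sum_congr rfl fun i _ => ?_
        simp [ite_mul]
        ring
      · rw [sq, Finset.sum_mul_sum, Finset.sum_div]
        refine Finset.sum_congr rfl fun i _ => ?_
        rw [Finset.sum_div]
        refine Finset.sum_congr rfl fun j _ => ?_
        ring
    rw [h1, sub_nonneg, div_le_iff₀ hM]
    -- Cauchy–Schwarz for `√m` and `√r x` is exactly the positivity needed.
    have h2 := Finset.sum_mul_sq_le_sq_mul_sq Finset.univ (fun i => √(m i))
      (fun i => √(r i) * x i)
    have h3 (i : ι) : √(m i) * (√(r i) * x i) = √(m i * r i) * x i := by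
      rw [Real.sqrt_mul (hm i)]; ring
    simp only [mul_pow, Real.sq_sqrt (hm _), Real.sq_sqrt (hr _), h3] at h2
    linarith

lemma mul_inv_add_re_pos {p : ℂ} (hp : 0 < p.re) {r : ℝ} (hr : 0 ≤ r) :
    0 < (p * (p + (r : ℂ))⁻¹).re := by
  have h := (isStieltjes_inv_add hr).mul_re_pos hp
  exact h

lemma add_ofReal_ne_zero {p : ℂ} (hp : 0 < p.re) {r : ℝ} (hr : 0 ≤ r) : p + (r : ℂ) ≠ 0 :=
  ne_zero_of_re_pos (by simpa using by linarith)

lemma sum_re_pos {ι : Type*} [Fintype ι] {m : ι → ℝ} (hm : ∀ i, 0 ≤ m i) (hM : 0 < ∑ i, m i)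
    {z : ι → ℂ} (hz : ∀ i, 0 < (z i).re) : 0 < (∑ i, (m i : ℂ) * z i).re := by
  obtain ⟨i, -, hi⟩ := Finset.exists_lt_of_sum_lt (f := fun _ => (0 : ℝ)) (by simpa using hM)
  rw [Complex.re_sum]
  refine Finset.sum_pos' (fun j _ => ?_) ⟨i, Finset.mem_univ _, ?_⟩
  · rw [Complex.re_ofReal_mul]; exact mul_nonneg (hm j) (hz j).le
  · rw [Complex.re_ofReal_mul]; exact mul_pos hi (hz i)

/-- Write the sum as `q = M - f` with `f = ⟨v, (p + diag r)⁻¹ v⟩`, `v = √(m r)`. Sherman–Morrison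
gives `1 / q = 1 / M + ⟨v, (p + T)⁻¹ v⟩ / M²` with `T = diag r - v vᵀ / M`, and diagonalizing `T ≥
0` turns the last term into simple poles with non-negative weights. -/
lemma exists_inv_sum_eq {ι : Type*} [Fintype ι] {m r : ι → ℝ}
    (hm : ∀ i, 0 ≤ m i) (hr : ∀ i, 0 ≤ r i) (hM : 0 < ∑ i, m i) :
    ∃ w l : ι → ℝ, (∀ k, 0 ≤ w k) ∧ (∀ k, 0 ≤ l k) ∧ ∀ p : ℂ, 0 < p.re →
      (∑ i, (m i : ℂ) * (p * (p + (r i : ℂ))⁻¹))⁻¹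
        = ((∑ i, m i)⁻¹ : ℝ) + ∑ k, (w k : ℂ) * (p + (l k : ℂ))⁻¹ := by
  classical
  obtain ⟨e, l, hl, he, hee⟩ := exists_eigenbasis (posSemidef_rankOneDowndate hm hr hM)
  set M := ∑ i, m i with hMdef
  let v : ι → ℝ := fun i => √(m i * r i)
  have hv (i : ι) : v i * v i = m i * r i := Real.mul_self_sqrt (mul_nonneg (hm i) (hr i))
  refine ⟨fun k => (∑ i, v i * e k i) ^ 2 / M ^ 2, l, fun k => by positivity, hl, fun p hp => ?_⟩
  set q := ∑ i, (m i : ℂ) * (p * (p + (r i : ℂ))⁻¹) with hq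
  have hq0 : q ≠ 0 := ne_zero_of_re_pos (sum_re_pos hm hM fun i => mul_inv_add_re_pos hp (hr i))
  have hM0 : (M : ℂ) ≠ 0 := by exact_mod_cast hM.ne'
  set f := ∑ i, (v i : ℂ) * ((v i : ℂ) * (p + (r i : ℂ))⁻¹) with hf
  have hqf : q = M - f := by
    rw [hq, hf, hMdef]
    push_cast
    rw [← Finset.sum_sub_distrib]
    refine Finset.sum_congr rfl fun i _ => ?_
    have h1 := add_ofReal_ne_zero hp (hr i)
    have h2 : (v i : ℂ) * v i = m i * r i := by exact_mod_cast hv i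
    rw [← mul_assoc (v i : ℂ), h2]
    field_simp
    ring
  -- This is `(p + T)⁻¹ v` in closed form, as `hTx` verifies.
  let x : ι → ℂ := fun i => M / q * ((v i : ℂ) * (p + (r i : ℂ))⁻¹)
  have hvx : ∑ i, (v i : ℂ) * x i = M / q * f := by
    rw [hf, Finset.mul_sum]
    exact Finset.sum_congr rfl fun i _ => by simp only [x]; ring
  have hTx (i : ι) : p * x i + ∑ j, (rankOneDowndate m r i j : ℂ) * x j = v i := by
    have h1 : ∑ j, (rankOneDowndate m r i j : ℂ) * x j = r i * x i - v i / M * (M / q * f) := by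
      rw [← hvx, Finset.mul_sum]
      have (j : ι) : (rankOneDowndate m r i j : ℂ) * x j
          = (if i = j then (r i : ℂ) * x j else 0) - v i / M * (v j * x j) := by
        simp only [rankOneDowndate, Matrix.of_apply, ← hMdef]
        split_ifs <;> push_cast <;> simp only [v] <;> ring
      simp only [this, Finset.sum_sub_distrib]
      simp
    have h2 := add_ofReal_ne_zero hp (hr i)
    have h3 : (p + r i) * x i = M / q * v i := by
      simp only [x]; field_simp
    have hff : f = M - q := by rw [hqf]; ring
    calc _ = (p + r i) * x i - v i / M * (M / q * f) := by rw [h1]; ring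
      _ = _ := by rw [h3, hff]; field_simp; ring
  have hsymm (i j : ι) : rankOneDowndate m r i j = rankOneDowndate m r j i := by
    simpa using congrFun (congrFun (posSemidef_rankOneDowndate hm hr hM).1 j) i
  have hcomp (k : ι) : ∑ i, (e k i : ℂ) * x i
      = (∑ i, v i * e k i : ℝ) * (p + (l k : ℂ))⁻¹ := by
    have h1 : ∑ i, (e k i : ℂ) * (∑ j, (rankOneDowndate m r i j : ℂ) * x j)
        = l k * ∑ j, (e k j : ℂ) * x j := by
      simp only [Finset.mul_sum]
      rw [Finset.sum_comm]
      refine Finset.sum_congr rfl fun j _ => ?_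
      have h2 : ∑ i, (rankOneDowndate m r j i : ℂ) * e k i = l k * e k j := by
        exact_mod_cast he k j
      rw [← mul_assoc, ← h2, Finset.sum_mul]
      exact Finset.sum_congr rfl fun i _ => by rw [hsymm i j]; ring
    have h3 : ∑ i, (e k i : ℂ) * v i
        = p * (∑ i, (e k i : ℂ) * x i) + l k * ∑ i, (e k i : ℂ) * x i := by
      rw [← h1, Finset.mul_sum, ← Finset.sum_add_distrib]
      refine Finset.sum_congr rfl fun i _ => ?_
      rw [← hTx i]; ring
    rw [eq_mul_inv_iff_mul_eq₀ (add_ofReal_ne_zero hp (hl k))]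
    push_cast
    rw [show ∑ i, (v i : ℂ) * e k i = ∑ i, (e k i : ℂ) * v i from
      Finset.sum_congr rfl fun i _ => mul_comm _ _, h3]
    ring
  have hpars : ∑ k, ((∑ i, v i * e k i : ℝ) : ℂ) * ∑ i, (e k i : ℂ) * x i
      = ∑ i, (v i : ℂ) * x i := by
    push_cast
    simp only [Finset.sum_mul_sum]
    rw [Finset.sum_comm]
    refine Finset.sum_congr rfl fun i _ => ?_
    rw [Finset.sum_comm]
    have h1 (j : ι) : ∑ k, (v i : ℂ) * e k i * (e k j * x j)
        = if i = j then (v i : ℂ) * x j else 0 := by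
      have h2 : ∑ k, (e k i : ℂ) * e k j = if i = j then 1 else 0 := by
        have h3 := congrArg (fun y : ℝ => (y : ℂ)) (hee i j)
        simpa [apply_ite] using h3
      calc _ = (v i : ℂ) * x j * ∑ k, (e k i : ℂ) * e k j := by
            rw [Finset.mul_sum]
            exact Finset.sum_congr rfl fun k _ => by ring
        _ = _ := by rw [h2]; split_ifs <;> simp
    simp [h1]
  have hsum : ∑ k, (((∑ i, v i * e k i) ^ 2 / M ^ 2 : ℝ) : ℂ) * (p + (l k : ℂ))⁻¹
      = (1 / M ^ 2) * (M / q * f) := by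
    rw [← hvx, ← hpars, Finset.mul_sum]
    refine Finset.sum_congr rfl fun k _ => ?_
    rw [hcomp k]
    push_cast
    ring
  rw [hsum, show f = M - q by rw [hqf]; ring]
  push_cast
  field_simp
  ring

/-- Nodes below `1` correspond to finite rates `r = u / (1 - u)`, with weights rescaled by `1 / (1 -
u)`. -/
lemma isStieltjes_inv_mul_sum {ι : Type*} [Fintype ι] {m : ι → ℝ} {u : ι → unitInterval}
    (hm : ∀ i, 0 ≤ m i) (hu : ∀ i, u i < 1) (hM : 0 < ∑ i, m i) :
    IsStieltjes fun p => (p * ∑ i, (m i : ℂ) * (den p (u i))⁻¹)⁻¹ := by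
  have hu' (i : ι) : 0 < 1 - (u i : ℝ) := sub_pos.2 (hu i)
  have hm' (i : ι) : 0 ≤ m i / (1 - (u i : ℝ)) := div_nonneg (hm i) (hu' i).le
  have hr' (i : ι) : 0 ≤ (u i : ℝ) / (1 - (u i : ℝ)) := div_nonneg (u i).2.1 (hu' i).le
  have hM' : 0 < ∑ i, m i / (1 - (u i : ℝ)) := by
    refine hM.trans_le (Finset.sum_le_sum fun i _ => ?_)
    rw [le_div_iff₀ (hu' i)]
    nlinarith [(u i).2.1, hm i]
  obtain ⟨w, l, hw, hl, h⟩ := exists_inv_sum_eq hm' hr' hM'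
  refine ((isStieltjes_const (inv_pos.2 hM')).add_sum Finset.univ hw hl).congr fun p hp => ?_
  rw [← h p hp, Finset.mul_sum]
  congr 1
  refine Finset.sum_congr rfl fun i _ => ?_
  have h1 : (1 - ((u i : ℝ) : ℂ)) ≠ 0 := by exact_mod_cast (hu' i).ne'
  have h2 := add_ofReal_ne_zero hp (hr' i)
  have h3 := den_ne_zero hp (u i)
  have h4 : den p (u i) = (1 - ((u i : ℝ) : ℂ)) * (p + (((u i : ℝ) / (1 - (u i : ℝ)) : ℝ) : ℂ)) := by
    simp only [den]
    push_cast
    field_simp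
  rw [h4]
  push_cast at h2 ⊢
  field_simp

theorem IsStieltjes.inv_mul {F : ℂ → ℂ} (hF : IsStieltjes F) :
    IsStieltjes fun p => (p * F p)⁻¹ := by
  have h1 : (0 : ℝ) < (1 : ℂ).re := by simp
  have hF1 := ne_zero_of_re_pos (hF.mul_re_pos h1)
  have hF' := hF
  obtain ⟨σ, _, hσ, h⟩ := hF
  have h0 : (0 : unitInterval) ∈ Set.Iio 1 := by simp
  -- Simple approximations of the identity with values in `[0, 1[`, so that the pushed-forward
  -- measures are finitely supported away from `u = 1`.
  let s : ℕ → SimpleFunc unitInterval unitInterval :=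
    SimpleFunc.approxOn id measurable_id (Set.Iio 1) 0 h0
  have hs1 (n : ℕ) (u : unitInterval) : s n u < 1 :=
    SimpleFunc.approxOn_mem measurable_id h0 n u
  have hlim (u : unitInterval) : Tendsto (fun n => s n u) atTop (𝓝 u) := by
    refine SimpleFunc.tendsto_approxOn measurable_id h0 ?_
    rw [closure_Iio' ⟨0, h0⟩]
    exact u.2.2
  have hden1 (u : unitInterval) : den 1 u = 1 := by simp [den]
  refine IsStieltjes.of_tendsto (F := fun n p => (p * ∫ u, (den p (s n u))⁻¹ ∂σ)⁻¹)
    (fun n => ?_) (inv_ne_zero hF1) fun p hp => ?_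
  · let t : unitInterval → (s n).range := fun u => ⟨s n u, (s n).mem_range_self u⟩
    have ht : Measurable t := (s n).measurable.subtype_mk
    let m : (s n).range → ℝ := fun i => (σ.map t).real {i}
    have hsum (p : ℂ) (hp : 0 < p.re) :
        ∫ u, (den p (s n u))⁻¹ ∂σ = ∑ i, (m i : ℂ) * (den p i)⁻¹ := by
      have h2 : ∫ u, (den p (s n u))⁻¹ ∂σ = ∫ i, (den p (i : unitInterval))⁻¹ ∂(σ.map t) := by
        rw [integral_map ht.aemeasurable]
        exact (measurable_of_finite _).aestronglyMeasurable
      rw [h2, integral_fintype (Integrable.of_finite)]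
      simp [m]
    refine (isStieltjes_inv_mul_sum (m := m) (u := fun i => (i : unitInterval))
      (fun i => measureReal_nonneg) ?_ ?_).congr fun p hp => ?_
    · rintro ⟨i, hi⟩
      obtain ⟨u, rfl⟩ := SimpleFunc.mem_range.1 hi
      exact hs1 n u
    · have h3 := hsum 1 h1
      simp only [hden1, inv_one, mul_one, integral_const, Complex.real_smul] at h3
      have h4 : ∑ i, m i = σ.real Set.univ := by exact_mod_cast h3.symm
      rw [h4, measureReal_def]
      exact ENNReal.toReal_pos (by simpa using hσ) (by simp)
    · rw [hsum p hp]
  · refine Tendsto.inv₀ (Tendsto.const_mul _ ?_) (ne_zero_of_re_pos (hF'.mul_re_pos hp))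
    rw [h p hp]
    refine tendsto_integral_of_dominated_convergence (fun _ => (min p.re 1)⁻¹) (fun n => ?_)
      (integrable_const _) (fun n => Eventually.of_forall fun u => norm_inv_den_le hp _)
      (Eventually.of_forall fun u => ((continuous_inv_den hp).tendsto u).comp (hlim u))
    exact ((continuous_inv_den hp).measurable.comp (s n).measurable).aestronglyMeasurable

/-! ### Square roots by Newton's iteration. -/

lemma cpow_half_re_pos {z : ℂ} (hz : z ∈ Complex.slitPlane) : 0 < (z ^ (1 / 2 : ℂ)).re := by
  have hz0 : z ≠ 0 := Complex.slitPlane_ne_zero hz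
  have h1 : (Complex.log z * (1 / 2)).im = z.arg / 2 := by
    simp [Complex.log_im, Complex.mul_im]
    ring
  rw [Complex.cpow_def_of_ne_zero hz0, Complex.exp_re, h1]
  refine mul_pos (Real.exp_pos _) (Real.cos_pos_of_mem_Ioo ⟨?_, ?_⟩)
  · linarith [Complex.neg_pi_lt_arg z]
  · linarith [(Complex.arg_le_pi z).lt_of_ne (Complex.mem_slitPlane_iff_arg.1 hz).1]

lemma cpow_half_sq (z : ℂ) : (z ^ (1 / 2 : ℂ)) ^ 2 = z := by
  simp

/-- Newton's iteration for the square root of `q⁻¹`, started at `1`. -/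
noncomputable def invSqrtIter (q : ℂ) : ℕ → ℂ
  | 0 => 1
  | n + 1 => (invSqrtIter q n + (q * invSqrtIter q n)⁻¹) / 2

/-- The Cayley transform `y = (x - a) / (x + a)` conjugates the iteration to `y ↦ y²`, and `‖y 0‖ <
1` because `a = q^(-1/2)` has positive real part. -/
lemma tendsto_invSqrtIter {q : ℂ} (hq : q ∈ Complex.slitPlane)
    (hpos : ∀ n, 0 < (invSqrtIter q n).re) :
    Tendsto (invSqrtIter q) atTop (𝓝 (q ^ (1 / 2 : ℂ))⁻¹) := by
  set a := (q ^ (1 / 2 : ℂ))⁻¹ with ha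
  have hare : 0 < a.re := inv_re_pos (cpow_half_re_pos hq)
  have ha0 : a ≠ 0 := ne_zero_of_re_pos hare
  have hqa : q⁻¹ = a ^ 2 := by rw [ha, inv_pow, cpow_half_sq]
  let y : ℕ → ℂ := fun n => (invSqrtIter q n - a) / (invSqrtIter q n + a)
  have hxa (n : ℕ) : invSqrtIter q n + a ≠ 0 :=
    ne_zero_of_re_pos (by rw [Complex.add_re]; linarith [hpos n])
  have hy (n : ℕ) : y n = y 0 ^ 2 ^ n := by
    induction n with
    | zero => simp
    | succ n ih =>
      rw [pow_succ, pow_mul, ← ih]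
      have h1 := hxa n
      have h2 := hxa (n + 1)
      have h3 := ne_zero_of_re_pos (hpos n)
      have h4 : invSqrtIter q (n + 1) = (invSqrtIter q n ^ 2 + a ^ 2) / (2 * invSqrtIter q n) := by
        rw [invSqrtIter, mul_inv, hqa]
        field_simp
      simp only [y, div_pow]
      rw [div_eq_div_iff h2 (pow_ne_zero 2 h1), h4]
      field_simp
      ring
  have hy0 : ‖y 0‖ < 1 := by
    have h1 : ‖1 - a‖ < ‖1 + a‖ := by
      rw [← sq_lt_sq₀ (norm_nonneg _) (norm_nonneg _), ← Complex.normSq_eq_norm_sq,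
        ← Complex.normSq_eq_norm_sq, Complex.normSq_apply, Complex.normSq_apply]
      simp only [Complex.sub_re, Complex.add_re, Complex.sub_im, Complex.add_im, Complex.one_re,
        Complex.one_im]
      nlinarith
    simp only [y, invSqrtIter, norm_div]
    exact (div_lt_one ((norm_nonneg _).trans_lt h1)).2 h1
  have hlim : Tendsto y atTop (𝓝 0) := by
    have h1 : Tendsto (fun n : ℕ => 2 ^ n) atTop atTop :=
      tendsto_pow_atTop_atTop_of_one_lt one_lt_two
    exact ((tendsto_pow_atTop_nhds_zero_of_norm_lt_one hy0).comp h1).congr fun n => (hy n).symm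
  have hx (n : ℕ) : invSqrtIter q n = a * (1 + y n) / (1 - y n) := by
    have h1 := hxa n
    have h2 : 1 - y n = 2 * a / (invSqrtIter q n + a) := by
      simp only [y]; field_simp; ring
    have h3 : 1 + y n = 2 * invSqrtIter q n / (invSqrtIter q n + a) := by
      simp only [y]; field_simp; ring
    rw [h2, h3]
    field_simp
  have h5 : Tendsto (fun n => a * (1 + y n) / (1 - y n)) atTop
      (𝓝 (a * (1 + 0) / (1 - 0))) :=
    ((hlim.const_add 1).const_mul a).div (hlim.const_sub 1) (by simp)
  simpa [← hx] using h5

/-- The two statements need each other. With `x` the iterate and `q = p F`, the next `x` averages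
`x` and `1 / (q x)`, while the next `1 / (q x)` is their harmonic mean `2 / (q x + 1 / x)`, reached
by the involution on each, a sum, and the involution again. -/
lemma IsStieltjes.invSqrtIter {F : ℂ → ℂ} (hF : IsStieltjes F) (n : ℕ) :
    IsStieltjes (fun p => invSqrtIter (p * F p) n) ∧
      IsStieltjes fun p => (p * F p * Viscoelastic.invSqrtIter (p * F p) n)⁻¹ := by
  have half : (0 : ℝ) < 1 / 2 := by norm_num
  induction n with
  | zero =>
    refine ⟨(isStieltjes_const one_pos).congr fun p _ => by simp [Viscoelastic.invSqrtIter],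
      hF.inv_mul.congr fun p _ => by simp [Viscoelastic.invSqrtIter]⟩
  | succ n ih =>
    obtain ⟨h1, h2⟩ := ih
    refine ⟨((h1.add h2).smul half).congr fun p _ => ?_,
      ((h1.inv_mul.add h2.inv_mul).inv_mul.smul two_pos).congr fun p hp => ?_⟩
    · rw [Viscoelastic.invSqrtIter]
      push_cast
      ring
    · have h3 := ne_zero_of_re_pos (h1.re_pos hp)
      have h4 := ne_zero_of_re_pos (hF.re_pos hp)
      have h5 := ne_zero_of_re_pos hp
      have h6 := ne_zero_of_re_pos ((h1.add h2).re_pos hp)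
      rw [Viscoelastic.invSqrtIter]
      beta_reduce at h6 ⊢
      have h7 := ne_zero_of_re_pos ((h1.inv_mul.add h2.inv_mul).re_pos hp)
      beta_reduce at h7
      push_cast
      set x := Viscoelastic.invSqrtIter (p * F p) n
      have h8 : (p * ((p * x)⁻¹ + (p * (p * F p * x)⁻¹)⁻¹)) = p * F p * (x + (p * F p * x)⁻¹) := by
        field_simp
        ring
      rw [h8]
      field_simp

theorem IsStieltjes.inv_sqrt_mul {F : ℂ → ℂ} (hF : IsStieltjes F) :
    IsStieltjes fun p => ((p * F p) ^ (1 / 2 : ℂ))⁻¹ := by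
  have hslit {p : ℂ} (hp : 0 < p.re) : p * F p ∈ Complex.slitPlane :=
    Complex.mem_slitPlane_iff.2 (Or.inl (hF.mul_re_pos hp))
  refine IsStieltjes.of_tendsto (fun n => (hF.invSqrtIter n).1) ?_ fun p hp =>
    tendsto_invSqrtIter (hslit hp) fun n => (hF.invSqrtIter n).1.re_pos hp
  exact inv_ne_zero (ne_zero_of_re_pos (cpow_half_re_pos (hslit (by simp))))

/-! ### Integrability against relaxation measures; complete monotonicity. -/

lemma IsSpectralMeasure.isRelaxationMeasure {ν : Measure ℝ} (hν : IsSpectralMeasure ν) :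
    IsRelaxationMeasure ν :=
  ⟨measure_mono_null Set.Iio_subset_Iic_self hν.1, hν.2⟩

lemma IsRelaxationMeasure.ae_nonneg {μ : Measure ℝ} (hμ : IsRelaxationMeasure μ) :
    ∀ᵐ r ∂μ, 0 ≤ r := by
  rw [ae_iff]
  simpa [Set.Iio] using hμ.1

lemma IsSpectralMeasure.ae_pos {ν : Measure ℝ} (hν : IsSpectralMeasure ν) :
    ∀ᵐ r ∂ν, 0 < r := by
  rw [ae_iff]
  simpa [Set.Iic] using hν.1

/-- The absolute value makes the density positive on all of `ℝ`, hence invertible everywhere. -/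
lemma measurable_ofReal_inv_one_add_abs :
    Measurable fun r : ℝ => ENNReal.ofReal (1 / (1 + |r|)) := by
  fun_prop

lemma IsRelaxationMeasure.isFiniteMeasure_withDensity {μ : Measure ℝ}
    (hμ : IsRelaxationMeasure μ) :
    IsFiniteMeasure (μ.withDensity fun r => ENNReal.ofReal (1 / (1 + |r|))) := by
  refine MeasureTheory.isFiniteMeasure_withDensity ?_
  have : ∫⁻ r, ENNReal.ofReal (1 / (1 + |r|)) ∂μ = ∫⁻ r, ENNReal.ofReal (1 / (1 + r)) ∂μ := by
    refine lintegral_congr_ae ?_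
    filter_upwards [hμ.ae_nonneg] with r hr
    rw [abs_of_nonneg hr]
  rw [this]
  exact hμ.2.ne

lemma IsRelaxationMeasure.sFinite {μ : Measure ℝ} (hμ : IsRelaxationMeasure μ) : SFinite μ := by
  have := hμ.isFiniteMeasure_withDensity
  rw [← withDensity_inv_same (μ := μ) measurable_ofReal_inv_one_add_abs]
  · infer_instance
  · refine Eventually.of_forall fun r => ?_
    simp only [ne_eq, ENNReal.ofReal_eq_zero, not_le]
    positivity
  · exact Eventually.of_forall fun r => ENNReal.ofReal_ne_top

lemma IsRelaxationMeasure.integrable {E : Type*} [NormedAddCommGroup E] {μ : Measure ℝ}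
    (hμ : IsRelaxationMeasure μ) {f : ℝ → E} (hf : AEStronglyMeasurable f μ) {C : ℝ}
    (hC : ∀ᵐ r ∂μ, ‖f r‖ ≤ C * (1 / (1 + r))) : Integrable f μ := by
  refine Integrable.mono' (g := fun r => C * (1 / (1 + r))) (Integrable.const_mul ?_ C) hf hC
  refine ⟨Measurable.aestronglyMeasurable (by fun_prop), ?_⟩
  rw [hasFiniteIntegral_iff_ofReal]
  · exact hμ.2
  · filter_upwards [hμ.ae_nonneg] with r hr
    simp only [Pi.zero_apply]
    positivity

lemma exp_neg_mul_le {t r : ℝ} (ht : 0 < t) (hr : 0 ≤ r) :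
    Real.exp (-(t * r)) ≤ (1 + t⁻¹) * (1 / (1 + r)) := by
  have h1 : 0 < 1 + t * r := by positivity
  have h2 : 1 + t * r ≤ Real.exp (t * r) := by linarith [Real.add_one_le_exp (t * r)]
  rw [Real.exp_neg]
  refine (inv_anti₀ h1 h2).trans ?_
  rw [mul_one_div, inv_eq_one_div, div_le_div_iff₀ h1 (by positivity)]
  have h3 : (1 + t⁻¹) * (1 + t * r) = 1 + t⁻¹ + t * r + r := by field_simp; ring
  rw [h3]
  have : 0 < t⁻¹ := inv_pos.2 ht
  nlinarith [mul_nonneg ht.le hr]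

lemma IsRelaxationMeasure.integrable_exp {μ : Measure ℝ} (hμ : IsRelaxationMeasure μ) {t : ℝ}
    (ht : 0 < t) : Integrable (fun r => Real.exp (-(t * r))) μ := by
  refine hμ.integrable (C := 1 + t⁻¹) (by fun_prop) ?_
  filter_upwards [hμ.ae_nonneg] with r hr
  rw [Real.norm_eq_abs, Real.abs_exp]
  exact exp_neg_mul_le ht hr

lemma norm_inv_add_le {p : ℂ} (hp : 0 < p.re) {r : ℝ} (hr : 0 ≤ r) :
    ‖1 / (p + (r : ℂ))‖ ≤ (1 + p.re⁻¹) * (1 / (1 + r)) := by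
  have h1 : p.re + r ≤ ‖p + r‖ := by simpa using Complex.re_le_norm (p + r)
  rw [norm_div, norm_one]
  refine (one_div_le_one_div_of_le (by linarith) h1).trans ?_
  rw [mul_one_div, div_le_div_iff₀ (by linarith) (by linarith)]
  have h3 : (1 + p.re⁻¹) * (p.re + r) = p.re + r + 1 + p.re⁻¹ * r := by field_simp; ring
  rw [h3]
  have : 0 ≤ p.re⁻¹ * r := mul_nonneg (inv_nonneg.2 hp.le) hr
  linarith

lemma IsRelaxationMeasure.integrable_inv_add {μ : Measure ℝ} (hμ : IsRelaxationMeasure μ) {p : ℂ}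
    (hp : 0 < p.re) : Integrable (fun r : ℝ => 1 / (p + (r : ℂ))) μ := by
  refine hμ.integrable (C := 1 + p.re⁻¹)
    (Measurable.aestronglyMeasurable (by fun_prop)) ?_
  filter_upwards [hμ.ae_nonneg] with r hr using norm_inv_add_le hp hr

/-- The function is the moment generating function of `r ↦ -r`, analytic on `]0, ∞[`, with `n`-th
derivative `∫ (-r)^n e^{-tr} μ(dr)`. -/
theorem IsRelaxationMeasure.isCompletelyMonotone {μ : Measure ℝ} (hμ : IsRelaxationMeasure μ)
    {f : ℝ → ℝ} (hf : ∀ t : ℝ, 0 < t → f t = ∫ r, Real.exp (-(t * r)) ∂μ) :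
    IsCompletelyMonotone f := by
  have hmem {t : ℝ} (ht : 0 < t) :
      t ∈ interior (ProbabilityTheory.integrableExpSet (fun r : ℝ => -r) μ) := by
    refine interior_maximal (t := Set.Ioi 0) (fun s hs => ?_) isOpen_Ioi
      (Set.mem_Ioi.2 ht)
    simpa [ProbabilityTheory.integrableExpSet] using hμ.integrable_exp hs
  have heq : Set.EqOn f (ProbabilityTheory.mgf (fun r : ℝ => -r) μ) (Set.Ioi 0) := fun t ht => by
    rw [hf t ht, ProbabilityTheory.mgf]
    simp
  refine ⟨ContDiffOn.congr (fun t ht => ?_) heq, fun n t ht => ?_⟩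
  · exact (ProbabilityTheory.analyticAt_mgf (hmem ht)).contDiffAt.contDiffWithinAt
  · have h1 : f =ᶠ[𝓝 t] ProbabilityTheory.mgf (fun r : ℝ => -r) μ :=
      heq.eventuallyEq_of_mem (Ioi_mem_nhds ht)
    rw [h1.iteratedDeriv_eq n, ProbabilityTheory.iteratedDeriv_mgf (hmem ht),
      ← integral_const_mul]
    refine integral_nonneg_of_ae ?_
    filter_upwards [hμ.ae_nonneg] with r hr
    rw [← mul_assoc, ← mul_pow]
    simp only [Pi.zero_apply]
    have : -1 * -r = r := by ring
    rw [this]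
    positivity

/-! ### Laplace transforms of superpositions; Bernstein functions. -/

/-- Laplace transform of a superposition of non-negative functions. -/
lemma laplace_superposition {μ : Measure ℝ} [SFinite μ] {k : ℝ → ℝ → ℝ}
    (hk : Measurable (Function.uncurry k)) {f : ℝ → ℝ}
    (hf : ∀ t : ℝ, 0 < t → f t = ∫ r, k t r ∂μ) {p : ℂ}
    (h0 : ∀ᵐ r ∂μ, ∀ t : ℝ, 0 < t → 0 ≤ k t r) {L : ℝ → ℂ} {l : ℝ → ℝ}
    (hi : ∀ᵐ r ∂μ, IntegrableOn (fun t : ℝ => Complex.exp (-p * (t : ℂ)) * (k t r : ℂ)) (Set.Ioi 0))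
    (hL : ∀ᵐ r ∂μ, ∫ t in Set.Ioi (0 : ℝ), Complex.exp (-p * (t : ℂ)) * (k t r : ℂ) = L r)
    (hl : ∀ᵐ r ∂μ, ∫ t in Set.Ioi (0 : ℝ), Real.exp (-p.re * t) * k t r = l r)
    (hI : Integrable l μ) :
    IntegrableOn (fun t : ℝ => Complex.exp (-p * (t : ℂ)) * (f t : ℂ)) (Set.Ioi 0) ∧
      laplace f p = ∫ r, L r ∂μ := by
  have heq (t : ℝ) (ht : t ∈ Set.Ioi (0 : ℝ)) : Complex.exp (-p * (t : ℂ)) * (f t : ℂ)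
      = ∫ r, Complex.exp (-p * (t : ℂ)) * (k t r : ℂ) ∂μ := by
    rw [integral_const_mul, hf t ht, integral_complex_ofReal]
  have hmeas : Measurable
      (Function.uncurry fun (t r : ℝ) => Complex.exp (-p * (t : ℂ)) * (k t r : ℂ)) := by
    refine Measurable.mul ?_ (Complex.measurable_ofReal.comp hk)
    have : Measurable fun t : ℝ => Complex.exp (-p * (t : ℂ)) := by fun_prop
    exact this.comp measurable_fst
  have hprod : Integrable
      (Function.uncurry fun (t r : ℝ) => Complex.exp (-p * (t : ℂ)) * (k t r : ℂ))
      ((volume.restrict (Set.Ioi (0 : ℝ))).prod μ) := by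
    -- By non-negativity of `k`, the norm of the integrand integrates in `t` to the transform at
    -- `p.re`, which is `l`.
    rw [integrable_prod_iff' hmeas.aestronglyMeasurable]
    refine ⟨hi, hI.congr ?_⟩
    filter_upwards [hl, h0] with r hr h0r
    rw [← hr]
    refine setIntegral_congr_fun measurableSet_Ioi fun t ht => ?_
    simp only [Function.uncurry_apply_pair]
    rw [norm_mul, Complex.norm_exp, Complex.norm_real, Real.norm_of_nonneg (h0r t ht)]
    simp
  constructor
  · refine IntegrableOn.congr_fun (f := fun t : ℝ => ∫ r, Complex.exp (-p * (t : ℂ)) * (k t r : ℂ) ∂μ)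
      ?_ (fun t ht => (heq t ht).symm) measurableSet_Ioi
    exact hprod.integral_prod_left
  · rw [laplace, setIntegral_congr_fun measurableSet_Ioi heq, integral_integral_swap hprod]
    exact integral_congr_ae hL

lemma integrableOn_cexp_neg_mul {z : ℂ} (hz : 0 < z.re) :
    IntegrableOn (fun t : ℝ => Complex.exp (-z * (t : ℂ))) (Set.Ioi 0) :=
  integrableOn_exp_mul_complex_Ioi (by simpa using hz) 0

lemma integral_cexp_neg_mul {z : ℂ} (hz : 0 < z.re) :
    ∫ t in Set.Ioi (0 : ℝ), Complex.exp (-z * (t : ℂ)) = 1 / z := by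
  rw [integral_exp_mul_complex_Ioi (by simpa using hz)]
  simp [neg_div_neg_eq]

lemma ofReal_setIntegral_eq {h : ℝ → ℝ} {z : ℝ}
    (H : ∫ t in Set.Ioi (0 : ℝ), (h t : ℂ) = (z : ℂ)) : ∫ t in Set.Ioi (0 : ℝ), h t = z := by
  rw [integral_complex_ofReal] at H
  exact_mod_cast H

lemma cexp_mul_exp (p : ℂ) (r t : ℝ) :
    Complex.exp (-p * (t : ℂ)) * (Real.exp (-(t * r)) : ℂ) = Complex.exp (-(p + r) * (t : ℂ)) := by
  push_cast
  rw [← Complex.exp_add]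
  congr 1
  ring

lemma integral_exp_mul_exp {s r : ℝ} (hs : 0 < s) (hr : 0 ≤ r) :
    ∫ t in Set.Ioi (0 : ℝ), Real.exp (-s * t) * Real.exp (-(t * r)) = 1 / (s + r) := by
  apply ofReal_setIntegral_eq
  have h := integral_cexp_neg_mul (z := (s : ℂ) + r) (by simpa using by linarith)
  push_cast
  rw [← h]
  refine setIntegral_congr_fun measurableSet_Ioi fun t _ => ?_
  rw [← cexp_mul_exp]
  push_cast
  rfl

lemma add_ofReal_re_pos {p : ℂ} (hp : 0 < p.re) {r : ℝ} (hr : 0 ≤ r) : 0 < (p + (r : ℂ)).re := by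
  simpa using by linarith

lemma IsRelaxationMeasure.laplace_eq {μ : Measure ℝ} (hμ : IsRelaxationMeasure μ)
    {f : ℝ → ℝ} (hf : ∀ t : ℝ, 0 < t → f t = ∫ r, Real.exp (-(t * r)) ∂μ) {p : ℂ}
    (hp : 0 < p.re) : laplace f p = ∫ r, 1 / (p + (r : ℂ)) ∂μ := by
  have := hμ.sFinite
  refine (laplace_superposition (k := fun t r => Real.exp (-(t * r)))
    (l := fun r => 1 / (p.re + r)) (by fun_prop) hf
    (Eventually.of_forall fun r t _ => (Real.exp_pos _).le) ?_ ?_ ?_ ?_).2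
  · filter_upwards [hμ.ae_nonneg] with r hr
    simp only [cexp_mul_exp]
    exact integrableOn_cexp_neg_mul (add_ofReal_re_pos hp hr)
  · filter_upwards [hμ.ae_nonneg] with r hr
    simp only [cexp_mul_exp]
    exact integral_cexp_neg_mul (add_ofReal_re_pos hp hr)
  · filter_upwards [hμ.ae_nonneg] with r hr using integral_exp_mul_exp hp hr
  · have h := (hμ.integrable_inv_add (p := (p.re : ℂ)) (by simpa using hp)).re
    refine h.congr (Eventually.of_forall fun r => ?_)
    simp only [RCLike.re_eq_complex_re]
    rw [← Complex.ofReal_add, ← Complex.ofReal_one, ← Complex.ofReal_div, Complex.ofReal_re]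

lemma integral_exp_mul_one_sub_exp_div {p : ℂ} (hp : 0 < p.re) {r : ℝ} (hr : 0 < r) :
    IntegrableOn (fun t : ℝ => Complex.exp (-p * (t : ℂ)) *
        (((1 - Real.exp (-(t * r))) / r : ℝ) : ℂ)) (Set.Ioi 0) ∧
      ∫ t in Set.Ioi (0 : ℝ), Complex.exp (-p * (t : ℂ)) *
        (((1 - Real.exp (-(t * r))) / r : ℝ) : ℂ) = 1 / (p * (p + r)) := by
  have h1 (t : ℝ) : Complex.exp (-p * (t : ℂ)) * (((1 - Real.exp (-(t * r))) / r : ℝ) : ℂ)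
      = (Complex.exp (-p * (t : ℂ)) - Complex.exp (-(p + r) * (t : ℂ))) / r := by
    rw [← cexp_mul_exp]
    push_cast
    ring
  simp only [h1]
  have h2 := integrableOn_cexp_neg_mul hp
  have h3 := integrableOn_cexp_neg_mul (add_ofReal_re_pos hp hr.le)
  refine ⟨(h2.sub h3).div_const _, ?_⟩
  rw [integral_div, integral_sub h2 h3, integral_cexp_neg_mul hp,
    integral_cexp_neg_mul (add_ofReal_re_pos hp hr.le)]
  have h4 := ne_zero_of_re_pos hp
  have h5 := add_ofReal_ne_zero hp hr.le
  have h6 : (r : ℂ) ≠ 0 := by exact_mod_cast hr.ne'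
  field_simp
  ring

/-- The Bernstein function with derivative `t ↦ ∫ e^{-tr} ν(dr)` and value `a` at `0`. -/
noncomputable def bernsteinOf (a : ℝ) (ν : Measure ℝ) (t : ℝ) : ℝ :=
  a + ∫ r, (1 - Real.exp (-(t * r))) / r ∂ν

lemma one_sub_exp_div_nonneg {t r : ℝ} (ht : 0 ≤ t) (hr : 0 < r) :
    0 ≤ (1 - Real.exp (-(t * r))) / r := by
  refine div_nonneg (sub_nonneg.2 (Real.exp_le_one_iff.2 ?_)) hr.le
  nlinarith [mul_nonneg ht hr.le]

lemma one_sub_exp_div_le {t r : ℝ} (hr : 0 < r) :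
    (1 - Real.exp (-(t * r))) / r ≤ (1 + t) * (1 / (1 + r)) := by
  rw [mul_one_div, div_le_div_iff₀ hr (by linarith)]
  have h1 := Real.add_one_le_exp (-(t * r))
  have h2 := Real.exp_pos (-(t * r))
  nlinarith

lemma IsSpectralMeasure.integrable_one_sub_exp_div {ν : Measure ℝ} (hν : IsSpectralMeasure ν)
    {t : ℝ} (ht : 0 ≤ t) : Integrable (fun r => (1 - Real.exp (-(t * r))) / r) ν := by
  refine hν.isRelaxationMeasure.integrable (C := 1 + t)
    (Measurable.aestronglyMeasurable (by fun_prop)) ?_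
  filter_upwards [hν.ae_pos] with r hr
  rw [Real.norm_of_nonneg (one_sub_exp_div_nonneg ht hr)]
  exact one_sub_exp_div_le hr

lemma IsSpectralMeasure.hasDerivAt_bernsteinOf {ν : Measure ℝ} (hν : IsSpectralMeasure ν) (a : ℝ)
    {t : ℝ} (ht : 0 < t) :
    HasDerivAt (bernsteinOf a ν) (∫ r, Real.exp (-(t * r)) ∂ν) t := by
  refine HasDerivAt.const_add a ?_
  refine (hasDerivAt_integral_of_dominated_loc_of_deriv_le (s := Set.Ioi (t / 2))
    (bound := fun r => Real.exp (-(t / 2 * r)))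
    (F := fun s r => (1 - Real.exp (-(s * r))) / r) (F' := fun s r => Real.exp (-(s * r)))
    (Ioi_mem_nhds (by linarith)) (Eventually.of_forall fun s =>
      Measurable.aestronglyMeasurable (by fun_prop))
    (hν.integrable_one_sub_exp_div ht.le) (by fun_prop) ?_
    (hν.isRelaxationMeasure.integrable_exp (by linarith)) ?_).2
  · filter_upwards [hν.ae_pos] with r hr s hs
    rw [Real.norm_eq_abs, Real.abs_exp, Real.exp_le_exp, neg_le_neg_iff]
    exact mul_le_mul_of_nonneg_right (le_of_lt hs) hr.le
  · filter_upwards [hν.ae_pos] with r hr s _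
    have h1 : HasDerivAt (fun s : ℝ => -(s * r)) (-r) s := by
      simpa using (hasDerivAt_mul_const (x := s) r).fun_neg
    have h2 := (h1.exp.const_sub 1).div_const r
    simpa [hr.ne'] using h2

theorem IsSpectralMeasure.isBernstein_bernsteinOf {ν : Measure ℝ} (hν : IsSpectralMeasure ν)
    {a : ℝ} (ha : 0 ≤ a) : IsBernstein (bernsteinOf a ν) := by
  refine ⟨fun t ht => (hν.hasDerivAt_bernsteinOf a ht).differentiableAt.differentiableWithinAt,
    fun t ht => add_nonneg ha (integral_nonneg_of_ae ?_),
    hν.isRelaxationMeasure.isCompletelyMonotone fun t ht => (hν.hasDerivAt_bernsteinOf a ht).deriv⟩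
  filter_upwards [hν.ae_pos] with r hr using one_sub_exp_div_nonneg ht.le hr

/-- By Fubini, since `(1 - e^{-tr}) / r` has transform `1 / (p (p + r))` and the constant `a` has
transform `a / p`. -/
theorem IsSpectralMeasure.laplace_bernsteinOf {ν : Measure ℝ} (hν : IsSpectralMeasure ν)
    (a : ℝ) {p : ℂ} (hp : 0 < p.re) :
    p ^ 2 * laplace (bernsteinOf a ν) p = p * a + p * ∫ r, 1 / (p + (r : ℂ)) ∂ν := by
  have := hν.isRelaxationMeasure.sFinite
  obtain ⟨h1, h2⟩ := laplace_superposition (μ := ν) (p := p)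
    (f := fun t => ∫ r, (1 - Real.exp (-(t * r))) / r ∂ν)
    (k := fun t r => (1 - Real.exp (-(t * r))) / r) (L := fun r => 1 / (p * (p + r)))
    (l := fun r => 1 / (p.re * (p.re + r))) (by fun_prop) (fun t _ => rfl)
    (by filter_upwards [hν.ae_pos] with r hr t ht using one_sub_exp_div_nonneg ht.le hr)
    (by filter_upwards [hν.ae_pos] with r hr using (integral_exp_mul_one_sub_exp_div hp hr).1)
    (by filter_upwards [hν.ae_pos] with r hr using (integral_exp_mul_one_sub_exp_div hp hr).2)
    (by
      filter_upwards [hν.ae_pos] with r hr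
      apply ofReal_setIntegral_eq
      have h := (integral_exp_mul_one_sub_exp_div (p := (p.re : ℂ)) (by simpa using hp) hr).2
      push_cast at h ⊢
      exact h)
    (by
      have h := ((hν.isRelaxationMeasure.integrable_inv_add (p := (p.re : ℂ))
        (by simpa using hp)).re).const_mul (1 / p.re)
      refine h.congr (Eventually.of_forall fun r => ?_)
      simp only [RCLike.re_eq_complex_re]
      rw [← Complex.ofReal_add, ← Complex.ofReal_one, ← Complex.ofReal_div, Complex.ofReal_re,
        one_div_mul_one_div])
  have h3 : laplace (bernsteinOf a ν) p = a / p + ∫ r, 1 / (p * (p + (r : ℂ))) ∂ν := by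
    rw [← h2, laplace, laplace, div_eq_mul_one_div, ← integral_cexp_neg_mul hp,
      ← integral_const_mul, ← integral_add ((integrableOn_cexp_neg_mul hp).const_mul _) h1]
    refine setIntegral_congr_fun measurableSet_Ioi fun t _ => ?_
    simp only [bernsteinOf]
    push_cast
    ring
  have h4 : ∫ r, 1 / (p * (p + (r : ℂ))) ∂ν = 1 / p * ∫ r, 1 / (p + (r : ℂ)) ∂ν := by
    rw [← integral_const_mul]
    exact integral_congr_ae (Eventually.of_forall fun r => (one_div_mul_one_div _ _).symm)
  have h5 := ne_zero_of_re_pos hp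
  rw [h3, h4]
  field_simp

/-! ### Passage between measures on the half-line and on the unit interval. -/

/-- The parametrization `r ↦ r / (1 + r)` of the half-line by the unit interval. -/
noncomputable def toUnit (r : ℝ) : unitInterval := Set.projIcc 0 1 zero_le_one (r / (1 + r))

lemma measurable_toUnit : Measurable toUnit :=
  (continuous_projIcc (h := zero_le_one)).measurable.comp (by fun_prop)

lemma coe_toUnit {r : ℝ} (hr : 0 ≤ r) : (toUnit r : ℝ) = r / (1 + r) := by
  rw [toUnit, Set.coe_projIcc, min_eq_right, max_eq_right]
  · positivity
  · exact (div_le_one (by linarith)).2 (by linarith)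

lemma inv_den_toUnit (p : ℂ) {r : ℝ} (hr : 0 ≤ r) :
    (den p (toUnit r))⁻¹ = (1 + r) * (1 / (p + r)) := by
  have h1 : (1 + (r : ℂ)) ≠ 0 := by exact_mod_cast (by linarith : 1 + r ≠ 0)
  have h2 : den p (toUnit r) = (p + r) / (1 + r) := by
    rw [den, coe_toUnit hr]
    push_cast
    field_simp
    ring
  rw [h2, inv_div, mul_one_div]

lemma IsRelaxationMeasure.isStieltjes {μ : Measure ℝ} (hμ : IsRelaxationMeasure μ) (hμ0 : μ ≠ 0)
    {F : ℂ → ℂ} (hF : ∀ p : ℂ, 0 < p.re → F p = ∫ r, 1 / (p + (r : ℂ)) ∂μ) : IsStieltjes F := by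
  have := hμ.isFiniteMeasure_withDensity
  have := hμ.sFinite
  refine ⟨(μ.withDensity fun r => ENNReal.ofReal (1 / (1 + |r|))).map toUnit, inferInstance, ?_,
    fun p hp => ?_⟩
  · rw [Ne, Measure.map_eq_zero_iff measurable_toUnit.aemeasurable, withDensity_eq_zero_iff
      measurable_ofReal_inv_one_add_abs.aemeasurable]
    intro h
    apply hμ0
    rw [← ae_eq_bot, ← Filter.eventually_false_iff_eq_bot]
    filter_upwards [h] with r hr
    have h1 : 0 < 1 / (1 + |r|) := by positivity
    exact (ENNReal.ofReal_pos.2 h1).ne' hr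
  · rw [hF p hp, integral_map measurable_toUnit.aemeasurable
      (continuous_inv_den hp).aestronglyMeasurable,
      integral_withDensity_eq_integral_toReal_smul measurable_ofReal_inv_one_add_abs
        (Eventually.of_forall fun r => ENNReal.ofReal_lt_top)]
    refine integral_congr_ae ?_
    filter_upwards [hμ.ae_nonneg] with r hr
    have h1 : 0 < 1 + r := by linarith
    have h2 : (1 + (r : ℂ)) ≠ 0 := by exact_mod_cast h1.ne'
    rw [inv_den_toUnit p hr, abs_of_nonneg hr, ENNReal.toReal_ofReal (by positivity),
      Complex.real_smul]
    push_cast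
    field_simp

/-- The image on `]0, ∞[` of the part of `σ` carried by the open unit interval. -/
noncomputable def spectralOf (σ : Measure unitInterval) : Measure ℝ :=
  ((σ.restrict (Set.Ioo 0 1)).withDensity fun u => ENNReal.ofReal (1 / (1 - (u : ℝ)))).map
    fun u : unitInterval => (u : ℝ) / (1 - u)

lemma measurable_coe_div_one_sub : Measurable fun u : unitInterval => (u : ℝ) / (1 - u) := by
  fun_prop

lemma measurable_ofReal_inv_one_sub :
    Measurable fun u : unitInterval => ENNReal.ofReal (1 / (1 - (u : ℝ))) := by
  fun_prop

lemma isSpectralMeasure_spectralOf (σ : Measure unitInterval) [IsFiniteMeasure σ] :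
    IsSpectralMeasure (spectralOf σ) := by
  constructor
  · rw [spectralOf, Measure.map_apply measurable_coe_div_one_sub measurableSet_Iic]
    refine withDensity_absolutelyContinuous _ _ ?_
    rw [Measure.restrict_apply (measurable_coe_div_one_sub measurableSet_Iic)]
    convert! measure_empty (μ := σ)
    ext u
    simp only [Set.mem_inter_iff, Set.mem_preimage, Set.mem_Iic, Set.mem_Ioo,
      Set.mem_empty_iff_false, iff_false, not_and, not_lt]
    intro h h0
    by_contra! h1
    exact absurd h (not_le.2 (div_pos (show (0 : ℝ) < u from h0)
      (sub_pos.2 (show (u : ℝ) < 1 from h1))))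
  · rw [spectralOf, lintegral_map (f := fun r : ℝ => ENNReal.ofReal (1 / (1 + r)))
        (by fun_prop) measurable_coe_div_one_sub,
      lintegral_withDensity_eq_lintegral_mul _ measurable_ofReal_inv_one_sub (by fun_prop)]
    calc _ = ∫⁻ u in Set.Ioo 0 1, 1 ∂σ := by
          refine setLIntegral_congr_fun measurableSet_Ioo fun u hu => ?_
          have h0 : (0 : ℝ) < u := hu.1
          have h1 : (0 : ℝ) < 1 - u := sub_pos.2 hu.2
          simp only [Pi.mul_apply]
          rw [← ENNReal.ofReal_mul (by positivity), ← ENNReal.ofReal_one]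
          congr 1
          field_simp
          ring
      _ < ⊤ := by simp

lemma integral_spectralOf (σ : Measure unitInterval) (p : ℂ) :
    ∫ r, 1 / (p + (r : ℂ)) ∂(spectralOf σ) = ∫ u in Set.Ioo 0 1, (den p u)⁻¹ ∂σ := by
  rw [spectralOf, integral_map measurable_coe_div_one_sub.aemeasurable
      (Measurable.aestronglyMeasurable (by fun_prop)),
    integral_withDensity_eq_integral_toReal_smul measurable_ofReal_inv_one_sub
        (Eventually.of_forall fun r => ENNReal.ofReal_lt_top)]
  refine setIntegral_congr_fun measurableSet_Ioo fun u hu => ?_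
  have h1 : (0 : ℝ) < 1 - u := sub_pos.2 hu.2
  have h2 : (1 - ((u : ℝ) : ℂ)) ≠ 0 := by exact_mod_cast h1.ne'
  have h3 : den p u = (1 - ((u : ℝ) : ℂ)) * (p + (((u : ℝ) / (1 - u) : ℝ) : ℂ)) := by
    rw [den]
    push_cast
    field_simp
  rw [ENNReal.toReal_ofReal (by positivity), Complex.real_smul, h3, mul_inv]
  push_cast
  rw [one_div, one_div]

/-- The endpoints are split off because they are not in `]0, ∞[`: the kernel is `1 / p` at `u = 0`
and `1` at `u = 1`. -/
lemma integral_inv_den_eq (σ : Measure unitInterval) [IsFiniteMeasure σ] {p : ℂ} (hp : 0 < p.re) :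
    ∫ u, (den p u)⁻¹ ∂σ
      = σ.real {0} * p⁻¹ + σ.real {1} + ∫ r, 1 / (p + (r : ℂ)) ∂(spectralOf σ) := by
  have hi := integrable_inv_den hp σ
  have h1 : ({0}ᶜ ∩ {1} : Set unitInterval) = {1} := by
    ext u; simp only [Set.mem_inter_iff, Set.mem_compl_iff, Set.mem_singleton_iff]
    exact ⟨fun h => h.2, fun h => ⟨by rw [h]; exact one_ne_zero, h⟩⟩
  have h2 : ({0}ᶜ \ {1} : Set unitInterval) = Set.Ioo 0 1 := by
    ext u
    simp only [Set.mem_sdiff, Set.mem_compl_iff, Set.mem_singleton_iff, Set.mem_Ioo]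
    exact ⟨fun h => ⟨unitInterval.pos_iff_ne_zero.2 h.1, unitInterval.lt_one_iff_ne_one.2 h.2⟩,
      fun h => ⟨h.1.ne', h.2.ne⟩⟩
  rw [integral_spectralOf, ← integral_add_compl (measurableSet_singleton 0) hi,
    ← integral_inter_add_sdiff (s := {0}ᶜ) (measurableSet_singleton (1 : unitInterval))
      hi.integrableOn, h1, h2,
    integral_singleton, integral_singleton]
  simp [den]
  ring

/-! ### Endpoint atoms as limits along the positive axis. -/

lemma den_ofReal (x : ℝ) (u : unitInterval) : den (x : ℂ) u = ((x * (1 - u) + u : ℝ) : ℂ) := by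
  simp [den]

/-- Dominated convergence: `x / den x u` is at most `1` for `0 < x < 1` and tends to the indicator
of `u = 0`. -/
lemma tendsto_mul_integral_inv_den_zero (σ : Measure unitInterval) [IsFiniteMeasure σ] :
    Tendsto (fun x : ℝ => (x : ℂ) * ∫ u, (den (x : ℂ) u)⁻¹ ∂σ) (𝓝[>] 0) (𝓝 (σ.real {0} : ℂ)) := by
  have h1 : (σ.real {0} : ℂ) = ∫ u, Set.indicator {0} (fun _ => (1 : ℂ)) u ∂σ := by
    rw [integral_indicator (measurableSet_singleton 0)]
    simp [measureReal_def]
  simp_rw [h1, ← integral_const_mul]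
  refine tendsto_integral_filter_of_dominated_convergence (fun _ => 1) ?_ ?_
    (integrable_const _) (Eventually.of_forall fun u => ?_)
  · filter_upwards [self_mem_nhdsWithin] with x hx
    exact ((continuous_inv_den (p := (x : ℂ)) (by simpa using hx)).const_mul _).aestronglyMeasurable
  · filter_upwards [Ioo_mem_nhdsGT (zero_lt_one' ℝ)] with x hx
    refine Eventually.of_forall fun u => ?_
    have h2 := norm_inv_den_le (p := (x : ℂ)) (by simpa using hx.1) u
    rw [Complex.ofReal_re, min_eq_left hx.2.le] at h2
    rw [norm_mul, Complex.norm_real, Real.norm_of_nonneg hx.1.le]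
    exact (mul_le_mul_of_nonneg_left h2 hx.1.le).trans_eq (mul_inv_cancel₀ hx.1.ne')
  · by_cases hu : u = 0
    · subst hu
      refine Tendsto.congr' ?_ tendsto_const_nhds
      filter_upwards [self_mem_nhdsWithin] with x hx
      have : (x : ℂ) ≠ 0 := by exact_mod_cast (ne_of_gt hx)
      simp [den, this]
    · rw [Set.indicator_of_notMem (by simpa using hu)]
      have hu' : ((u : ℝ) : ℂ) ≠ 0 := by
        exact_mod_cast fun h : (u : ℝ) = 0 => hu (Subtype.ext h)
      have hc : Tendsto (fun x : ℝ => (x : ℂ)) (𝓝[>] 0) (𝓝 0) :=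
        (Complex.continuous_ofReal.tendsto' 0 0 (by simp)).mono_left nhdsWithin_le_nhds
      have hd : Tendsto (fun x : ℝ => den (x : ℂ) u) (𝓝[>] 0) (𝓝 ((u : ℝ) : ℂ)) := by
        simpa [den] using (hc.mul_const (1 - ((u : ℝ) : ℂ))).add_const ((u : ℝ) : ℂ)
      simpa using hc.mul (hd.inv₀ hu')

lemma tendsto_integral_inv_den_atTop (σ : Measure unitInterval) [IsFiniteMeasure σ] :
    Tendsto (fun x : ℝ => ∫ u, (den (x : ℂ) u)⁻¹ ∂σ) atTop (𝓝 (σ.real {1} : ℂ)) := by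
  have h1 : (σ.real {1} : ℂ) = ∫ u, Set.indicator {1} (fun _ => (1 : ℂ)) u ∂σ := by
    rw [integral_indicator (measurableSet_singleton 1)]
    simp [measureReal_def]
  rw [h1]
  refine tendsto_integral_filter_of_dominated_convergence (fun _ => 1) ?_ ?_
    (integrable_const _) (Eventually.of_forall fun u => ?_)
  · filter_upwards [eventually_gt_atTop 0] with x hx
    exact (continuous_inv_den (p := (x : ℂ)) (by simpa using hx)).aestronglyMeasurable
  · filter_upwards [eventually_ge_atTop 1] with x hx
    refine Eventually.of_forall fun u => ?_
    have h2 := norm_inv_den_le (p := (x : ℂ)) (by simpa using by linarith) u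
    rwa [Complex.ofReal_re, min_eq_right hx, inv_one] at h2
  · by_cases hu : u = 1
    · subst hu
      simp [den]
    · rw [Set.indicator_of_notMem (by simpa using hu)]
      have hu' : (0 : ℝ) < 1 - u := sub_pos.2 (unitInterval.lt_one_iff_ne_one.2 hu)
      have hd : Tendsto (fun x : ℝ => x * (1 - (u : ℝ)) + u) atTop atTop :=
        tendsto_atTop_add_const_right _ _ (tendsto_id.atTop_mul_const hu')
      have h3 := (Complex.continuous_ofReal.tendsto 0).comp hd.inv_tendsto_atTop
      simpa [Function.comp_def, den_ofReal] using h3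

lemma integral_inv_den_im (σ : Measure unitInterval) (x : ℝ) :
    (∫ u, (den (x : ℂ) u)⁻¹ ∂σ).im = 0 := by
  simp_rw [den_ofReal, ← Complex.ofReal_inv]
  rw [integral_complex_ofReal, Complex.ofReal_im]

/-! ### The total mass of the spectrum and the wavefront speed. -/

lemma ofReal_integral_exp {μ : Measure ℝ} (hμ : IsRelaxationMeasure μ) {t : ℝ} (ht : 0 < t) :
    ENNReal.ofReal (∫ r, Real.exp (-(t * r)) ∂μ) = ∫⁻ r, ENNReal.ofReal (Real.exp (-(t * r))) ∂μ :=
  ofReal_integral_eq_lintegral_ofReal (hμ.integrable_exp ht)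
    (Eventually.of_forall fun _ => (Real.exp_pos _).le)

/-- `G(0+)` is the total mass of the relaxation spectrum. -/
lemma IsRelaxationMeasure.iSup_eq {μ : Measure ℝ} (hμ : IsRelaxationMeasure μ) {G : ℝ → ℝ}
    (hG : ∀ t : ℝ, 0 < t → G t = ∫ r, Real.exp (-(t * r)) ∂μ) :
    ⨆ t : Set.Ioi (0 : ℝ), ENNReal.ofReal (G t) = μ Set.univ := by
  apply le_antisymm
  · refine iSup_le fun ⟨t, ht⟩ => ?_
    rw [hG t ht, ofReal_integral_exp hμ ht, ← lintegral_one]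
    refine lintegral_mono_ae ?_
    filter_upwards [hμ.ae_nonneg] with r hr
    rw [ENNReal.ofReal_le_one, Real.exp_le_one_iff]
    have := mul_nonneg (le_of_lt ht) hr
    linarith
  · have h1 : Tendsto (fun n : ℕ => ∫⁻ r, ENNReal.ofReal (Real.exp (-(1 / ((n : ℝ) + 1) * r))) ∂μ)
        atTop (𝓝 (∫⁻ _, 1 ∂μ)) := by
      refine lintegral_tendsto_of_tendsto_of_monotone
        (fun n => Measurable.aemeasurable (by fun_prop)) ?_ (Eventually.of_forall fun r => ?_)
      · filter_upwards [hμ.ae_nonneg] with r hr m n hmn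
        refine ENNReal.ofReal_le_ofReal (Real.exp_le_exp.2 (neg_le_neg ?_))
        exact mul_le_mul_of_nonneg_right (Nat.one_div_le_one_div hmn) hr
      · have h2 : Tendsto (fun n : ℕ => Real.exp (-(1 / ((n : ℝ) + 1) * r))) atTop
            (𝓝 (Real.exp (-(0 * r)))) :=
          (Real.continuous_exp.tendsto _).comp
            ((tendsto_one_div_add_atTop_nhds_zero_nat (𝕜 := ℝ)).mul_const r).neg
        simpa using ENNReal.tendsto_ofReal h2
    rw [lintegral_one] at h1
    refine le_of_tendsto' h1 fun n => ?_
    have hn : (0 : ℝ) < 1 / ((n : ℝ) + 1) := Nat.one_div_pos_of_nat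
    rw [← ofReal_integral_exp hμ hn, ← hG _ hn]
    exact le_iSup (fun t : Set.Ioi (0 : ℝ) => ENNReal.ofReal (G t)) ⟨_, hn⟩

lemma IsRelaxationMeasure.tendsto_lintegral_div {μ : Measure ℝ} (hμ : IsRelaxationMeasure μ) :
    Tendsto (fun n : ℕ => ∫⁻ r, ENNReal.ofReal (n / (n + r)) ∂μ) atTop (𝓝 (μ Set.univ)) := by
  rw [← lintegral_one]
  refine lintegral_tendsto_of_tendsto_of_monotone
    (fun n => Measurable.aemeasurable (by fun_prop)) ?_ ?_
  · filter_upwards [hμ.ae_nonneg] with r hr m n hmn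
    refine ENNReal.ofReal_le_ofReal ?_
    have hmn' : (m : ℝ) ≤ n := by exact_mod_cast hmn
    -- For `m = 0` the ratio is `0`, also at `r = 0` where `0 / 0 = 0`.
    rcases (Nat.cast_nonneg (α := ℝ) m).eq_or_lt with h | h
    · rw [← h, zero_div]
      positivity
    · rw [div_le_div_iff₀ (by linarith) (by linarith)]
      nlinarith [mul_le_mul_of_nonneg_right hmn' hr]
  · filter_upwards [hμ.ae_nonneg] with r hr
    have h2 := ENNReal.tendsto_ofReal (tendsto_natCast_div_add_atTop (𝕜 := ℝ) r)
    simpa using h2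

/-- The real value of `Q` at a positive argument. -/
lemma IsRelaxationMeasure.Q_ofReal {μ : Measure ℝ} (hμ : IsRelaxationMeasure μ) {G : ℝ → ℝ}
    (hG : ∀ t : ℝ, 0 < t → G t = ∫ r, Real.exp (-(t * r)) ∂μ) {x : ℝ} (hx : 0 < x) :
    ∃ q : ℝ, Q G x = q ∧ ENNReal.ofReal q = ∫⁻ r, ENNReal.ofReal (x / (x + r)) ∂μ := by
  have hx' : 0 < (x : ℂ).re := by simpa using hx
  have heq (r : ℝ) : (x : ℂ) * (1 / ((x : ℂ) + r)) = ((x / (x + r) : ℝ) : ℂ) := by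
    push_cast
    ring
  have hi := (hμ.integrable_inv_add hx').const_mul (x : ℂ)
  simp only [heq] at hi
  refine ⟨∫ r, x / (x + r) ∂μ, ?_, ?_⟩
  · rw [Q, hμ.laplace_eq hG hx', ← integral_const_mul]
    simp only [heq]
    exact integral_complex_ofReal
  · refine ofReal_integral_eq_lintegral_ofReal ?_ ?_
    · exact hi.re.congr (Eventually.of_forall fun r => Complex.ofReal_re _)
    · filter_upwards [hμ.ae_nonneg] with r hr
      simp only [Pi.zero_apply]
      positivity

lemma ofReal_inv_sqrt {ρ q : ℝ} (hρ : 0 < ρ) (hq : 0 < q) :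
    ((ENNReal.ofReal q / ENNReal.ofReal ρ) ^ (1 / 2 : ℝ))⁻¹ = ENNReal.ofReal (√ρ / √q) := by
  rw [← ENNReal.ofReal_div_of_pos hρ, ENNReal.ofReal_rpow_of_pos (div_pos hq hρ),
    ← ENNReal.ofReal_inv_of_pos (by positivity), ← Real.sqrt_eq_rpow, Real.sqrt_div hq.le, inv_div]

lemma cpow_half_ofReal {q : ℝ} (hq : 0 ≤ q) : (q : ℂ) ^ (1 / 2 : ℂ) = (√q : ℂ) := by
  rw [Real.sqrt_eq_rpow, Complex.ofReal_cpow hq]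
  norm_num

lemma wavefrontSpeed_pos {ρ : ℝ} {G : ℝ → ℝ} (h : ⨆ t : Set.Ioi (0 : ℝ), ENNReal.ofReal (G t) ≠ 0) :
    0 < wavefrontSpeed ρ G := by
  rw [wavefrontSpeed, pos_iff_ne_zero, Ne, ENNReal.rpow_eq_zero_iff_of_pos (by norm_num),
    ENNReal.div_eq_zero_iff]
  simpa using h

end Viscoelastic

open Viscoelastic in
theorem mainTheorem1 (ρ : ℝ) (hρ : 0 < ρ) (G : ℝ → ℝ)
    (hG : Viscoelastic.HasPositiveRelaxationSpectrum G) (hG0 : ∃ t : ℝ, 0 < t ∧ G t ≠ 0) :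
    -- the relaxation modulus is completely monotone
    Viscoelastic.IsCompletelyMonotone G ∧
    -- on the positive half-line `B` is real-valued, and it is a complete Bernstein function
    (∀ x : ℝ, 0 < x → (Viscoelastic.B ρ G (x : ℂ)).im = 0) ∧
    Viscoelastic.IsCompleteBernstein (fun x : ℝ => (Viscoelastic.B ρ G (x : ℂ)).re) ∧
    -- the wavefront speed is positive, possibly infinite, and `1 / c₀` is the limit of `B(p) / p`
    0 < Viscoelastic.wavefrontSpeed ρ G ∧
    Filter.Tendsto (fun x : ℝ => Viscoelastic.B ρ G (x : ℂ) / (x : ℂ)) Filter.atTop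
      (nhds (((Viscoelastic.wavefrontSpeed ρ G)⁻¹.toReal : ℝ) : ℂ)) ∧
    -- `B(p) = p / c₀ + b(p)` for `Re p > 0`, where `b` is admissible
    ∃ b : ℂ → ℂ, Viscoelastic.IsAdmissible b ∧
      ∀ p : ℂ, 0 < p.re →
        Viscoelastic.B ρ G p
          = p * (((Viscoelastic.wavefrontSpeed ρ G)⁻¹.toReal : ℝ) : ℂ) + b p := by
  obtain ⟨μ, hμ, hGμ⟩ := hG
  have hμ0 : μ ≠ 0 := by
    rintro rfl
    obtain ⟨t, ht, hGt⟩ := hG0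
    exact hGt (by simp [hGμ t ht])
  have hS : IsStieltjes (laplace G) := hμ.isStieltjes hμ0 fun p hp => hμ.laplace_eq hGμ hp
  have hc : 0 < wavefrontSpeed ρ G := by
    apply wavefrontSpeed_pos
    rw [hμ.iSup_eq hGμ]
    simpa using hμ0
  have hpos {x : ℝ} (hx : 0 < x) : 0 < (x : ℂ).re := by simpa using hx
  obtain ⟨σ, _, -, hσ⟩ := hS.inv_sqrt_mul.smul (Real.sqrt_pos.2 hρ)
  obtain ⟨τ, _, -, hτ⟩ := hS.inv_mul
  have hB {p : ℂ} (hp : 0 < p.re) : B ρ G p = p * ∫ u, (den p u)⁻¹ ∂σ := by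
    rw [← hσ p hp, B, Q]
    ring
  have hBdiv {x : ℝ} (hx : 0 < x) : B ρ G x / x = ∫ u, (den x u)⁻¹ ∂σ := by
    rw [hB (hpos hx), mul_div_cancel_left₀ _ (ne_zero_of_re_pos (hpos hx))]
  have hreal {x : ℝ} (hx : 0 < x) : (B ρ G x).im = 0 := by
    rw [hB (hpos hx), Complex.im_ofReal_mul, integral_inv_den_im, mul_zero]
  have hlim : Tendsto (fun x : ℝ => B ρ G x / x) atTop (𝓝 (σ.real {1} : ℂ)) := by
    refine (tendsto_integral_inv_den_atTop σ).congr' ?_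
    filter_upwards [eventually_gt_atTop 0] with x hx using (hBdiv hx).symm
  -- With `H = B(x) / x`, one has `(x H)² = ρ x · x (1 / (x F))`. As `x → 0+`, the left side tends
  -- to `σ{0}²` and the right side to `ρ · 0 · τ{0}`.
  have hmass0 : (σ.real {0} : ℂ) = 0 := by
    have h1 := (tendsto_mul_integral_inv_den_zero σ).pow 2
    have h2 : Tendsto (fun x : ℝ => (x : ℂ)) (𝓝[>] 0) (𝓝 0) :=
      (Complex.continuous_ofReal.tendsto' 0 0 (by simp)).mono_left nhdsWithin_le_nhds
    have h3 := (h2.const_mul (ρ : ℂ)).mul (tendsto_mul_integral_inv_den_zero τ)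
    have h4 := tendsto_nhds_unique (h1.congr' ?_) h3
    · simpa using h4
    · filter_upwards [self_mem_nhdsWithin] with x hx
      have hx0 := ne_zero_of_re_pos (hpos hx)
      have h5 : (√ρ : ℂ) ^ 2 = ρ := by exact_mod_cast Real.sq_sqrt hρ.le
      rw [← hσ x (hpos hx), ← hτ x (hpos hx), mul_pow, mul_pow, inv_pow, cpow_half_sq, h5]
      ring
  -- Both sides are limits of `B(n) / n = √ρ / √Q(n)`, as `Q(n)` increases to the mass of `μ`,
  -- finite or not. Working with inverses in `ℝ≥0∞` covers `c₀ = ∞`; `c₀ > 0` makes the inverse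
  -- finite, where `toReal` is continuous.
  have hmass1 : (wavefrontSpeed ρ G)⁻¹.toReal = σ.real {1} := by
    have h1 : Tendsto (fun n : ℕ => ((∫⁻ r, ENNReal.ofReal (n / (n + r)) ∂μ) /
        ENNReal.ofReal ρ) ^ (1 / 2 : ℝ)) atTop (𝓝 (wavefrontSpeed ρ G)) := by
      rw [wavefrontSpeed, hμ.iSup_eq hGμ]
      exact (ENNReal.continuous_rpow_const.tendsto _).comp
        (ENNReal.Tendsto.div_const hμ.tendsto_lintegral_div (Or.inr (by simpa using hρ)))
    have h2 := (ENNReal.tendsto_toReal (ENNReal.inv_ne_top.2 hc.ne')).comp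
      (tendsto_inv_iff.2 h1)
    have h3 := (Complex.continuous_ofReal.tendsto _).comp h2
    have h4 := tendsto_nhds_unique (h3.congr' ?_) (hlim.comp tendsto_natCast_atTop_atTop)
    · exact_mod_cast h4
    · filter_upwards [eventually_gt_atTop 0] with n hn
      have hn' : (0 : ℝ) < n := by exact_mod_cast hn
      obtain ⟨q, hq, hq'⟩ := hμ.Q_ofReal hGμ hn'
      have hq0 : 0 < q := by
        have := hS.mul_re_pos (hpos hn')
        rw [← Q, hq] at this
        simpa using this
      simp only [Function.comp_apply]
      rw [← hq', ofReal_inv_sqrt hρ hq0, ENNReal.toReal_ofReal (by positivity), B, hq,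
        cpow_half_ofReal hq0.le]
      have := ne_zero_of_re_pos (hpos hn')
      push_cast at this ⊢
      field_simp
  have hν := isSpectralMeasure_spectralOf σ
  have hrep {p : ℂ} (hp : 0 < p.re) :
      B ρ G p = p * σ.real {1} + p * ∫ r, 1 / (p + (r : ℂ)) ∂(spectralOf σ) := by
    rw [hB hp, integral_inv_den_eq σ hp, hmass0]
    ring
  refine ⟨hμ.isCompletelyMonotone hGμ, fun x hx => hreal hx,
    ⟨bernsteinOf (σ.real {1}) (spectralOf σ), hν.isBernstein_bernsteinOf measureReal_nonneg,
      fun x hx => ?_⟩, hc, by rw [hmass1]; exact hlim,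
    fun p => p * ∫ r, 1 / (p + (r : ℂ)) ∂(spectralOf σ), ⟨_, hν, fun p _ => rfl⟩,
    fun p hp => by rw [hmass1, hrep hp]⟩
  rw [hν.laplace_bernsteinOf _ (hpos hx), ← hrep (hpos hx)]
  exact Complex.ext (by simp) (by simpa using (hreal hx).symm)
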